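/- Let $$\mathcal M_\Delta=\{(a,b)\in\mathbb R^2 : 0<a\le b\le c<1,\ c:=2-a-b\}$$ be the moduli space of triangles up to similarity: a similarity class is represented by its side lengths $a\le b\le c$ scaled so that $a+b+c=2$, and recorded by $(a,b)$. Let $\mu$ be the area measure (planar Lebesgue measure) on $\mathcal M_\Delta$. A lattice triangle is a non-degenerate triangle with vertices in $\mathbb Z^2$; it determines a point of $\mathcal M_\Delta$, namely its side lengths in increasing order divided by the semiperimeter. For $N\ge 1$ let $S_N$ be the finite weighted set of the points of $\mathcal M_\Delta$ determined by the lattice triangles with vertices in $[-N,N]^2$, where the weight of a point $p$ is the number of such triangles with similarity class $p$; let $w(S_N)$ be the sum of the weights and $\delta_{S_N}$ the corresponding weighted sum of point masses. Then $w(S_N)\to\infty$, but the sequence $(S_N)$ does not equidistribute in $\mathcal M_\Delta$: it is not true that $$\frac{\delta_{S_N}(R)}{w(S_N)}\longrightarrow\frac{\mu(R)}{\mu(\mathcal M_\Delta)}\qquad(N\to\infty)$$ for every domain $R\subset\mathcal M_\Delta$ (a connected, relatively open subset whose boundary in $\mathcal M_\Delta$ has zero area). Likewise, the probability measures $\frac1{w(S_N)}\delta_{S_N}$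 do not converge weakly to the normalized area measure $\mu/\mu(\mathcal M_\Delta)$ on $\mathcal M_\Delta$ as $N\to\infty$. -/

import Mathlib

open MeasureTheory Filter Topology

noncomputable section

namespace LatticeTriangles

/-! ### Finite weighted sets and equidistribution -/

/-- A finite weighted set of points of `X`: finitely many points (the support), each carrying a
positive integer weight. -/
abbrev WeightedSet (X : Type*) := X →₀ ℕ

/-- The sum of the weights. -/
def totalWeight {X : Type*} (S : WeightedSet X) : ℕ := S.sum fun _ w => w

/-- The sum of the point masses at the points of `S`, each multiplied by its weight. -/
def diracMeasure {X : Type*} [MeasurableSpace X] (S : WeightedSet X) : Measure X :=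
  ∑ p ∈ S.support, (S p : ENNReal) • Measure.dirac p

instance {X : Type*} [MeasurableSpace X] (S : WeightedSet X) :
    IsFiniteMeasure (diracMeasure S) := by
  refine ⟨?_⟩
  simp only [diracMeasure, Measure.finsetSum_apply, Measure.smul_apply, measure_univ,
    smul_eq_mul, mul_one]
  exact ENNReal.sum_lt_top.2 fun p _ => ENNReal.natCast_lt_top _

/-- The area measure on a planar region `X`: the area of `R ⊆ X` is its planar Lebesgue measure. -/
def area (X : Set (ℝ × ℝ)) : Measure X := (volume : Measure (ℝ × ℝ)).comap Subtype.val

/-- Equidistribution of a sequence of finite weighted subsets (with total weight tending to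
infinity) of a planar region `X` of finite positive area: for every domain `R` of `X`, the
proportion of the weight carried by `R` tends to the proportion of the area.
A domain of `X` is a connected open subset of `X` whose boundary in `X` has zero area. -/
def Equidistributes (X : Set (ℝ × ℝ)) (S : ℕ → WeightedSet X) : Prop :=
  ∀ R : Set X, IsOpen R → IsConnected R → area X (frontier R) = 0 →
    Tendsto (fun n => diracMeasure (S n) R / (totalWeight (S n) : ENNReal)) atTop
      (𝓝 (area X R / area X Set.univ))

/-! ### The moduli space of triangles -/

/-- The moduli space of triangles up to similarity. A similarity class is represented by its side
lengths `a ≤ b ≤ c`, scaled so that `a + b + c = 2`; then the strict triangle inequalities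
amount to `c < 1`. The triple is recorded by `(a, b)`, with `c = 2 - a - b`. -/
def ModuliSpace : Set (ℝ × ℝ) :=
  {p | 0 < p.1 ∧ p.1 ≤ p.2 ∧ p.2 ≤ 2 - p.1 - p.2 ∧ 2 - p.1 - p.2 < 1}

instance : Nonempty ModuliSpace :=
  ⟨⟨(2 / 3, 2 / 3), by norm_num [ModuliSpace]⟩⟩

instance : IsFiniteMeasure (area ModuliSpace) := by
  have hm : MeasurableSet ModuliSpace := by
    unfold ModuliSpace
    measurability
  refine ⟨?_⟩
  rw [area, comap_subtype_coe_apply hm, Set.image_univ, Subtype.range_coe]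
  have hsub : ModuliSpace ⊆ Set.Icc (0 : ℝ × ℝ) (1, 1) := by
    rintro ⟨a, b⟩ ⟨h1, h2, h3, h4⟩
    simp only at h1 h2 h3 h4
    exact ⟨⟨by simp; linarith, by simp; linarith⟩, ⟨by simp; linarith, by simp; linarith⟩⟩
  exact (measure_mono hsub).trans_lt isCompact_Icc.measure_lt_top

/-- The area measure on the moduli space, as a finite measure. -/
def areaMeasure : FiniteMeasure ModuliSpace := ⟨area ModuliSpace, inferInstance⟩

/-- The weighted counting measure of a finite weighted set, as a finite measure. -/
def countingMeasure (S : WeightedSet ModuliSpace) : FiniteMeasure ModuliSpace :=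
  ⟨diracMeasure S, inferInstance⟩

/-! ### Lattice triangles and their shapes -/

/-- A lattice point as a point of the Euclidean plane. -/
def toPlane (p : ℤ × ℤ) : EuclideanSpace ℝ (Fin 2) := !₂[(p.1 : ℝ), (p.2 : ℝ)]

/-- A lattice triangle, given by its set of vertices: three non-collinear lattice points. -/
structure LatticeTriangle where
  vertices : Finset (ℤ × ℤ)
  card_eq : vertices.card = 3
  not_collinear : ¬ Collinear ℝ (toPlane '' (vertices : Set (ℤ × ℤ)))

/-- The Euclidean distance of two lattice points. -/
def len (p q : ℤ × ℤ) : ℝ := dist (toPlane p) (toPlane q)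

/-- The vertices are named `A, B, C` so that the side lengths satisfy `|AB| ≤ |BC| ≤ |CA|`. -/
def LatticeTriangle.IsLabelling (T : LatticeTriangle) (A B C : ℤ × ℤ) : Prop :=
  T.vertices = {A, B, C} ∧ len A B ≤ len B C ∧ len B C ≤ len C A

/-- Half of the perimeter. -/
def semiperimeter (A B C : ℤ × ℤ) : ℝ := (len A B + len B C + len C A) / 2

lemma len_comm (p q : ℤ × ℤ) : len p q = len q p := dist_comm _ _

lemma LatticeTriangle.exists_labelling (T : LatticeTriangle) :
    ∃ v : (ℤ × ℤ) × (ℤ × ℤ) × (ℤ × ℤ), T.IsLabelling v.1 v.2.1 v.2.2 := by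
  obtain ⟨A, B, C, -, -, -, h⟩ := Finset.card_eq_three.1 T.card_eq
  have e1 : ({A, B, C} : Finset (ℤ × ℤ)) = {A, C, B} := by grind
  have e2 : ({A, B, C} : Finset (ℤ × ℤ)) = {B, A, C} := by grind
  have e3 : ({A, B, C} : Finset (ℤ × ℤ)) = {B, C, A} := by grind
  have e4 : ({A, B, C} : Finset (ℤ × ℤ)) = {C, A, B} := by grind
  have e5 : ({A, B, C} : Finset (ℤ × ℤ)) = {C, B, A} := by grind
  have c1 := len_comm A B
  have c2 := len_comm B C
  have c3 := len_comm C A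
  rcases le_total (len A B) (len B C) with h1 | h1 <;>
  rcases le_total (len B C) (len C A) with h2 | h2 <;>
  rcases le_total (len C A) (len A B) with h3 | h3
  · exact ⟨(A, B, C), h, h1, h2⟩
  · exact ⟨(A, B, C), h, h1, h2⟩
  · exact ⟨(C, A, B), h.trans e4, by linarith, by linarith⟩
  · exact ⟨(B, A, C), h.trans e2, by simp only; linarith, by simp only; linarith⟩
  · exact ⟨(B, C, A), h.trans e3, by simp only; linarith, by simp only; linarith⟩
  · exact ⟨(C, B, A), h.trans e5, by simp only; linarith, by simp only; linarith⟩
  · exact ⟨(A, C, B), h.trans e1, by simp only; linarith, by simp only; linarith⟩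
  · exact ⟨(A, C, B), h.trans e1, by simp only; linarith, by simp only; linarith⟩

lemma LatticeTriangle.IsLabelling.distinct {T : LatticeTriangle} {A B C : ℤ × ℤ}
    (h : T.IsLabelling A B C) : A ≠ B ∧ A ≠ C ∧ B ≠ C := by
  have h3 := T.card_eq
  rw [h.1] at h3
  refine ⟨?_, ?_, ?_⟩ <;> rintro rfl
  · have := Finset.card_le_two (a := A) (b := C)
    simp at h3; omega
  · have := Finset.card_le_two (a := B) (b := A)
    rw [Finset.insert_comm] at h3
    simp at h3; omega
  · have := Finset.card_le_two (a := A) (b := B)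
    simp at h3; omega

lemma toPlane_injective : Function.Injective toPlane := by
  intro p q h
  have h0 := congrArg (fun v : EuclideanSpace ℝ (Fin 2) => v 0) h
  have h1 := congrArg (fun v : EuclideanSpace ℝ (Fin 2) => v 1) h
  simp [toPlane] at h0 h1
  exact Prod.ext h0 h1

lemma len_pos {p q : ℤ × ℤ} (h : p ≠ q) : 0 < len p q :=
  dist_pos.2 (toPlane_injective.ne h)

/-- The normalized side lengths of a lattice triangle satisfy the inequalities that define the
moduli space. -/
lemma LatticeTriangle.IsLabelling.mem {T : LatticeTriangle} {A B C : ℤ × ℤ}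
    (h : T.IsLabelling A B C) :
    (len A B / semiperimeter A B C, len B C / semiperimeter A B C) ∈ ModuliSpace := by
  have hAB := len_pos h.distinct.1
  obtain ⟨h0, h1, h2⟩ := h
  have hs : 0 < semiperimeter A B C := by unfold semiperimeter; linarith
  have hlt : len C A < len A B + len B C := by
    have hle : len A C ≤ len A B + len B C := dist_triangle _ _ _
    rw [len_comm A C] at hle
    refine lt_of_le_of_ne hle fun he => T.not_collinear ?_
    rw [len_comm C A] at he
    have hw := (dist_add_dist_eq_iff.1 he.symm).collinear
    simpa [h0, Set.image_insert_eq] using hw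
  have hc : 2 - len A B / semiperimeter A B C - len B C / semiperimeter A B C
      = len C A / semiperimeter A B C := by
    field_simp
    unfold semiperimeter
    ring
  refine ⟨div_pos hAB hs, ?_, ?_, ?_⟩
  · exact div_le_div_of_nonneg_right h1 hs.le
  · simp only [hc]
    exact div_le_div_of_nonneg_right h2 hs.le
  · simp only [hc]
    rw [div_lt_one hs]
    unfold semiperimeter
    linarith

/-- The point of the moduli space determined by a lattice triangle: its two smaller side lengths
divided by the semiperimeter. (It does not depend on the labelling, see `shape_eq`.) -/
def LatticeTriangle.shape (T : LatticeTriangle) : ModuliSpace :=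
  ⟨_, T.exists_labelling.choose_spec.mem⟩

lemma LatticeTriangle.IsLabelling.unique {T : LatticeTriangle} {A B C A' B' C' : ℤ × ℤ}
    (h : T.IsLabelling A B C) (h' : T.IsLabelling A' B' C') :
    len A B = len A' B' ∧ len B C = len B' C' ∧ len C A = len C' A' := by
  obtain ⟨n1, n2, n3⟩ := h.distinct
  obtain ⟨m1, m2, m3⟩ := h'.distinct
  obtain ⟨h0, h1, h2⟩ := h
  obtain ⟨h0', h1', h2'⟩ := h'
  have c1 := len_comm A B
  have c2 := len_comm B C
  have c3 := len_comm C A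
  have hA : A' ∈ ({A, B, C} : Finset (ℤ × ℤ)) := by rw [← h0, h0']; simp
  have hB : B' ∈ ({A, B, C} : Finset (ℤ × ℤ)) := by rw [← h0, h0']; simp
  have hC : C' ∈ ({A, B, C} : Finset (ℤ × ℤ)) := by rw [← h0, h0']; simp
  simp only [Finset.mem_insert, Finset.mem_singleton] at hA hB hC
  clear h0 h0'
  rcases hA with rfl | rfl | rfl <;> rcases hB with rfl | rfl | rfl <;>
    rcases hC with rfl | rfl | rfl <;>
    first
    | exact absurd rfl m1
    | exact absurd rfl m2
    | exact absurd rfl m3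
    | (refine ⟨?_, ?_, ?_⟩ <;> linarith)

lemma LatticeTriangle.shape_eq (T : LatticeTriangle) {A B C : ℤ × ℤ} (h : T.IsLabelling A B C) :
    (T.shape : ℝ × ℝ) =
      (len A B / semiperimeter A B C, len B C / semiperimeter A B C) := by
  obtain ⟨e1, e2, e3⟩ := T.exists_labelling.choose_spec.unique h
  simp only [shape, semiperimeter, e1, e2, e3]

lemma LatticeTriangle.shape_eq_of_proportional {T T' : LatticeTriangle}
    {A B C A' B' C' : ℤ × ℤ} {r : ℝ} (hr : 0 < r) (h : T.IsLabelling A B C)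
    (h' : T'.vertices = {A', B', C'}) (e1 : len A B = r * len A' B')
    (e2 : len B C = r * len B' C') (e3 : len C A = r * len C' A') : T.shape = T'.shape := by
  have hl : T'.IsLabelling A' B' C' := by
    refine ⟨h', ?_, ?_⟩
    · exact le_of_mul_le_mul_left (by rw [← e1, ← e2]; exact h.2.1) hr
    · exact le_of_mul_le_mul_left (by rw [← e2, ← e3]; exact h.2.2) hr
  have hs : semiperimeter A B C = r * semiperimeter A' B' C' := by
    unfold semiperimeter
    rw [e1, e2, e3]
    ring
  apply Subtype.ext
  rw [T.shape_eq h, T'.shape_eq hl, hs, e1, e2, mul_div_mul_left _ _ hr.ne',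
    mul_div_mul_left _ _ hr.ne']

/-- Two lattice triangles determine the same point of the moduli space if and only if they are
similar, for a suitable correspondence of their vertices. -/
lemma LatticeTriangle.shape_eq_shape_iff (T T' : LatticeTriangle) :
    T.shape = T'.shape ↔ ∃ A B C A' B' C' : ℤ × ℤ,
      T.vertices = {A, B, C} ∧ T'.vertices = {A', B', C'} ∧
      Similar ![toPlane A, toPlane B, toPlane C] ![toPlane A', toPlane B', toPlane C'] := by
  constructor
  · intro h
    obtain ⟨⟨A, B, C⟩, hl⟩ := T.exists_labelling
    obtain ⟨⟨A', B', C'⟩, hl'⟩ := T'.exists_labelling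
    simp only at hl hl'
    refine ⟨A, B, C, A', B', C', hl.1, hl'.1, ?_⟩
    have hs : 0 < semiperimeter A B C := by
      have := len_pos hl.distinct.1
      unfold semiperimeter; linarith [hl.2.1, hl.2.2]
    have hs' : 0 < semiperimeter A' B' C' := by
      have := len_pos hl'.distinct.1
      unfold semiperimeter; linarith [hl'.2.1, hl'.2.2]
    have he := congrArg Subtype.val h
    rw [T.shape_eq hl, T'.shape_eq hl'] at he
    obtain ⟨p1, p2⟩ := Prod.ext_iff.1 he
    simp only at p1 p2
    have q1 : len A B = semiperimeter A B C / semiperimeter A' B' C' * len A' B' := by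
      rw [div_eq_div_iff hs.ne' hs'.ne'] at p1
      field_simp
      linarith
    have q2 : len B C = semiperimeter A B C / semiperimeter A' B' C' * len B' C' := by
      rw [div_eq_div_iff hs.ne' hs'.ne'] at p2
      field_simp
      linarith
    have t : len C A = 2 * semiperimeter A B C - len A B - len B C := by
      unfold semiperimeter; ring
    have t' : len C' A' = 2 * semiperimeter A' B' C' - len A' B' - len B' C' := by
      unfold semiperimeter; ring
    have q3 : len C A = semiperimeter A B C / semiperimeter A' B' C' * len C' A' := by
      rw [t, t', q1, q2]
      field_simp
    refine similar_iff_exists_pos_dist_eq.2 ⟨_, div_pos hs hs', ?_⟩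
    intro i j
    fin_cases i <;> fin_cases j <;> simp <;>
      first
      | exact q1
      | exact q2
      | exact q3
      | (rw [dist_comm, dist_comm (toPlane _) (toPlane A')]; exact q1)
      | (rw [dist_comm, dist_comm (toPlane _) (toPlane B')]; exact q2)
      | (rw [dist_comm, dist_comm (toPlane _) (toPlane C')]; exact q3)
  · rintro ⟨A, B, C, A', B', C', h, h', hsim⟩
    obtain ⟨r, hr, hd⟩ := similar_iff_exists_pos_dist_eq.1 hsim
    have d1 : len A B = r * len A' B' := hd 0 1
    have d2 : len B C = r * len B' C' := hd 1 2
    have d3 : len C A = r * len C' A' := hd 2 0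
    have d1' : len B A = r * len B' A' := hd 1 0
    have d2' : len C B = r * len C' B' := hd 2 1
    have d3' : len A C = r * len A' C' := hd 0 2
    have perm (X Y Z : ℤ × ℤ) : ({X, Y, Z} : Finset (ℤ × ℤ)) = {X, Z, Y} ∧
        ({X, Y, Z} : Finset (ℤ × ℤ)) = {Y, X, Z} ∧ ({X, Y, Z} : Finset (ℤ × ℤ)) = {Y, Z, X} ∧
        ({X, Y, Z} : Finset (ℤ × ℤ)) = {Z, X, Y} ∧ ({X, Y, Z} : Finset (ℤ × ℤ)) = {Z, Y, X} := by
      refine ⟨?_, ?_, ?_, ?_, ?_⟩ <;> grind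
    obtain ⟨e1, e2, e3, e4, e5⟩ := perm A B C
    obtain ⟨f1, f2, f3, f4, f5⟩ := perm A' B' C'
    have c1 := len_comm A B
    have c2 := len_comm B C
    have c3 := len_comm C A
    rcases le_total (len A B) (len B C) with h1 | h1 <;>
    rcases le_total (len B C) (len C A) with h2 | h2 <;>
    rcases le_total (len C A) (len A B) with h3 | h3
    · exact shape_eq_of_proportional hr ⟨h, h1, h2⟩ h' d1 d2 d3
    · exact shape_eq_of_proportional hr ⟨h, h1, h2⟩ h' d1 d2 d3
    · exact shape_eq_of_proportional hr ⟨h.trans e4, by linarith, by linarith⟩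
        (h'.trans f4) d3 d1 d2
    · exact shape_eq_of_proportional hr ⟨h.trans e2, by linarith, by linarith⟩
        (h'.trans f2) d1' d3' d2'
    · exact shape_eq_of_proportional hr ⟨h.trans e3, by linarith, by linarith⟩
        (h'.trans f3) d2 d3 d1
    · exact shape_eq_of_proportional hr ⟨h.trans e5, by linarith, by linarith⟩
        (h'.trans f5) d2' d1' d3'
    · exact shape_eq_of_proportional hr ⟨h.trans e1, by linarith, by linarith⟩
        (h'.trans f1) d3' d2' d1'
    · exact shape_eq_of_proportional hr ⟨h.trans e1, by linarith, by linarith⟩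
        (h'.trans f1) d3' d2' d1'

/-- The lattice triangles with all vertices in the square `[-N, N] × [-N, N]`. -/
def trianglesInSquare (N : ℕ) : Set LatticeTriangle :=
  {T | ∀ p ∈ T.vertices, |p.1| ≤ (N : ℤ) ∧ |p.2| ≤ (N : ℤ)}

lemma trianglesInSquare_finite (N : ℕ) : (trianglesInSquare N).Finite := by
  have hinj : Function.Injective LatticeTriangle.vertices := by
    rintro ⟨v, _, _⟩ ⟨w, _, _⟩ h
    simp only at h
    subst h
    rfl
  refine Set.Finite.of_finite_image (f := LatticeTriangle.vertices) ?_ hinj.injOn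
  refine (Finset.finite_toSet
    (Finset.Icc (-(N : ℤ)) N ×ˢ Finset.Icc (-(N : ℤ)) N).powerset).subset ?_
  rintro _ ⟨T, hT, rfl⟩
  simp only [Finset.coe_powerset, Set.mem_preimage, Set.mem_powerset_iff]
  intro p hp
  have := hT p hp
  simp only [abs_le] at this
  simp only [Finset.coe_product, Finset.coe_Icc, Set.mem_prod, Set.mem_Icc]
  exact this

/-- The weighted set of points of the moduli space determined by the lattice triangles in
`[-N, N] × [-N, N]`: the weight of a point is the number of these triangles with that shape. -/
def latticeShapes (N : ℕ) : WeightedSet ModuliSpace :=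
  ∑ T ∈ (trianglesInSquare_finite N).toFinset, Finsupp.single T.shape 1

end LatticeTriangles

end

/-!
Triangles with an almost straight angle are overrepresented among lattice triangles. In the moduli
space the longest normalized side `c` tends to `1` at the degenerate triangles, and the strip
`c > 1 - ε` has area of order `ε`. A triangle with all sides comparable to `m` and height `t` over
its longest side `c` has `a + b - c` of order `t ^ 2 / m`, because the first-order contributions of the two
shorter sides cancel (`add_le_of_near_segment`); so after normalization it lies in the strip as
soon as `t` is at most about `√ε * m`. Two vertices being given, the third one only has to lie in a
band of that width, which happens for a proportion of order `√ε`, much larger than `ε`.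

The lower bound for the number of flat triangles comes from an explicit injective family: two
vertices `A`, `C` and a column between them are chosen freely in suitable ranges, and the third
vertex is one of the `d` first lattice points above the line `AC` in this column (`aboveLine`,
`le_card_flat`). Counting all triangles crudely gives a proportion at least `1 / (30000 * D)` for
`ε = 1 / D ^ 2` (`card_trianglesInSquare_le_mul_flat`), against an area proportion at most
`200 / D ^ 2`; these contradict each other for large `D` (`not_tendsto_proportion_flat`). The strip
is a domain in the moduli space, which refutes equidistribution; as its frontier is null, the
portmanteau theorem refutes weak convergence with the same strip.
-/

open MeasureTheory Filter Topology

namespace LatticeTriangles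

/-! ### Lattice shapes as a sum over triangles -/

lemma totalWeight_latticeShapes (N : ℕ) :
    totalWeight (latticeShapes N) = (trianglesInSquare_finite N).toFinset.card := by
  unfold totalWeight latticeShapes
  rw [← Finsupp.sum_finsetSum_index (fun _ => rfl) (fun _ _ _ => rfl)]
  simp

lemma diracMeasure_latticeShapes_apply (N : ℕ) {R : Set ModuliSpace} (hR : MeasurableSet R)
    [DecidablePred fun T : LatticeTriangle => T.shape ∈ R] :
    diracMeasure (latticeShapes N) R =
      (((trianglesInSquare_finite N).toFinset.filter fun T => T.shape ∈ R).card : ENNReal) := by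
  have h : diracMeasure (latticeShapes N) =
      (latticeShapes N).sum fun p w => (w : ENNReal) • Measure.dirac p := rfl
  rw [h, latticeShapes, ← Finsupp.sum_finsetSum_index (fun _ => by simp)
    (fun _ _ _ => by push_cast; rw [add_smul])]
  simp only [Nat.cast_zero, zero_smul, Finsupp.sum_single_index, Nat.cast_one, one_smul,
    Measure.finsetSum_apply, Measure.dirac_apply' _ hR, Set.indicator_apply, Pi.one_apply,
    Finset.sum_boole]

/-! ### Areas of regions of the moduli space -/

lemma measurableSet_moduliSpace : MeasurableSet ModuliSpace := by
  unfold ModuliSpace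
  measurability

lemma area_moduliSpace_apply (R : Set ModuliSpace) :
    area ModuliSpace R = volume (Subtype.val '' R) := by
  rw [area, comap_subtype_coe_apply measurableSet_moduliSpace]

lemma le_area_moduliSpace : ENNReal.ofReal (1 / 200) ≤ area ModuliSpace Set.univ := by
  -- The moduli space contains a rectangle of area `1 / 200`.
  have hsub : Set.Icc (11 / 20 : ℝ) (3 / 5) ×ˢ Set.Icc (3 / 5 : ℝ) (7 / 10) ⊆ ModuliSpace := by
    rintro ⟨a, b⟩ ⟨⟨h1, h2⟩, ⟨h3, h4⟩⟩
    simp only at h1 h2 h3 h4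
    refine ⟨?_, ?_, ?_, ?_⟩ <;> simp only <;> linarith
  rw [area_moduliSpace_apply, Set.image_univ, Subtype.range_coe]
  refine le_trans (le_of_eq ?_) (measure_mono hsub)
  rw [Measure.volume_eq_prod, Measure.prod_prod, Real.volume_Icc, Real.volume_Icc,
    ← ENNReal.ofReal_mul (by norm_num)]
  norm_num

/-- The shapes with longest normalized side `c > 1 - ε`: since `c = 1` for degenerate triangles,
these are the shapes of nearly degenerate triangles. -/
def flatShapes (ε : ℝ) : Set ModuliSpace := {p | p.1.1 + p.1.2 < 1 + ε}

lemma isOpen_flatShapes (ε : ℝ) : IsOpen (flatShapes ε) :=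
  isOpen_lt (by fun_prop) continuous_const

lemma isConnected_flatShapes {ε : ℝ} (h0 : 0 < ε) (h1 : ε < 1 / 3) :
    IsConnected (flatShapes ε) := by
  refine ⟨⟨⟨(1 / 2, 1 / 2 + ε / 2), ?_⟩, ?_⟩, ?_⟩
  · refine ⟨?_, ?_, ?_, ?_⟩ <;> simp only <;> linarith
  · simp only [flatShapes, Set.mem_ofPred_eq]
    linarith
  · rw [← Topology.IsInducing.subtypeVal.isPreconnected_image]
    have : (Subtype.val '' flatShapes ε) =
        {p : ℝ × ℝ | p ∈ ModuliSpace ∧ p.1 + p.2 < 1 + ε} := by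
      ext p
      simp [flatShapes, and_comm]
    rw [this]
    refine Convex.isPreconnected ?_
    rintro ⟨a, b⟩ ⟨⟨p1, p2, p3, p4⟩, p5⟩ ⟨a', b'⟩ ⟨⟨q1, q2, q3, q4⟩, q5⟩ s t hs ht hst
    simp only at p1 p2 p3 p4 p5 q1 q2 q3 q4 q5
    obtain rfl : t = 1 - s := by linarith
    refine ⟨⟨?_, ?_, ?_, ?_⟩, ?_⟩ <;>
      simp only [Prod.smul_mk, Prod.mk_add_mk, smul_eq_mul] <;>
      rcases hs.eq_or_lt with rfl | hs <;> nlinarith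

lemma area_frontier_flatShapes (ε : ℝ) : area ModuliSpace (frontier (flatShapes ε)) = 0 := by
  have hsub : Subtype.val '' frontier (flatShapes ε) ⊆ {p : ℝ × ℝ | p.1 + p.2 = 1 + ε} := by
    rintro _ ⟨p, hp, rfl⟩
    exact frontier_lt_subset_eq (f := fun p : ModuliSpace => p.1.1 + p.1.2)
      (by fun_prop) continuous_const hp
  have hm : MeasurableSet {p : ℝ × ℝ | p.1 + p.2 = 1 + ε} :=
    (isClosed_eq (by fun_prop) continuous_const).measurableSet
  rw [area_moduliSpace_apply]
  refine measure_mono_null hsub ?_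
  rw [Measure.volume_eq_prod, Measure.measure_prod_null hm]
  refine Eventually.of_forall fun x => ?_
  have : Prod.mk x ⁻¹' {p : ℝ × ℝ | p.1 + p.2 = 1 + ε} = {1 + ε - x} := by
    ext y
    simp only [Set.mem_preimage, Set.mem_ofPred_eq, Set.mem_singleton_iff]
    constructor <;> intro h <;> linarith
  simp [this]

lemma area_flatShapes_le {ε : ℝ} (h0 : 0 < ε) :
    area ModuliSpace (flatShapes ε) ≤ ENNReal.ofReal ε := by
  have hsub : Subtype.val '' flatShapes ε ⊆
      regionBetween (fun x => 1 - x) (fun x => 1 - x + ε) (Set.Icc 0 1) := by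
    rintro _ ⟨⟨⟨a, b⟩, h1, h2, h3, h4⟩, h5, rfl⟩
    simp only [flatShapes, Set.mem_ofPred_eq] at h1 h2 h3 h4 h5
    refine ⟨⟨?_, ?_⟩, ?_, ?_⟩ <;> simp only <;> linarith
  rw [area_moduliSpace_apply]
  refine (measure_mono hsub).trans (le_of_eq ?_)
  rw [Measure.volume_eq_prod, volume_regionBetween_eq_integral
    (Continuous.integrableOn_Icc (by fun_prop)) (Continuous.integrableOn_Icc (by fun_prop))
    measurableSet_Icc (fun x _ => by linarith)]
  simp

/-! ### Flat triangles -/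

/-- Every side of the triangle is at most the longest one, whose normalized length is
`2 - a - b`; so any side bounds `a + b` from above. -/
lemma LatticeTriangle.shape_add_le (T : LatticeTriangle) {A B C : ℤ × ℤ}
    (h : T.vertices = {A, B, C}) :
    T.shape.1.1 + T.shape.1.2 ≤ 2 - len C A / semiperimeter A B C := by
  obtain ⟨⟨A', B', C'⟩, hl⟩ := T.exists_labelling
  simp only at hl
  obtain ⟨n1, n2, n3⟩ := hl.distinct
  have hl0 := hl
  obtain ⟨h0', h1', h2'⟩ := hl
  have hcard := T.card_eq
  have c1 := len_comm A' B'
  have c2 := len_comm B' C'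
  have c3 := len_comm C' A'
  have hp := len_pos n1
  have key : semiperimeter A B C = semiperimeter A' B' C' ∧ len C A ≤ len C' A' := by
    have hA : A ∈ ({A', B', C'} : Finset (ℤ × ℤ)) := by rw [← h0', h]; simp
    have hB : B ∈ ({A', B', C'} : Finset (ℤ × ℤ)) := by rw [← h0', h]; simp
    have hC : C ∈ ({A', B', C'} : Finset (ℤ × ℤ)) := by rw [← h0', h]; simp
    have m1 : A ≠ B := by
      rintro rfl
      have := Finset.card_le_two (a := A) (b := C)
      rw [h] at hcard
      simp at hcard; omega
    have m2 : A ≠ C := by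
      rintro rfl
      have := Finset.card_le_two (a := B) (b := A)
      rw [h, Finset.insert_comm] at hcard
      simp at hcard; omega
    have m3 : B ≠ C := by
      rintro rfl
      have := Finset.card_le_two (a := A) (b := B)
      rw [h] at hcard
      simp at hcard; omega
    simp only [Finset.mem_insert, Finset.mem_singleton] at hA hB hC
    clear h h0' hl0
    unfold semiperimeter
    rcases hA with rfl | rfl | rfl <;> rcases hB with rfl | rfl | rfl <;>
      rcases hC with rfl | rfl | rfl <;>
      first
      | exact absurd rfl m1
      | exact absurd rfl m2
      | exact absurd rfl m3
      | (refine ⟨?_, ?_⟩ <;> linarith)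
  rw [T.shape_eq hl0, key.1]
  have hs : 0 < semiperimeter A' B' C' := by unfold semiperimeter; linarith
  have : len C A / semiperimeter A' B' C' ≤ len C' A' / semiperimeter A' B' C' :=
    div_le_div_of_nonneg_right key.2 hs.le
  have hc : len A' B' / semiperimeter A' B' C' + len B' C' / semiperimeter A' B' C'
      = 2 - len C' A' / semiperimeter A' B' C' := by
    field_simp
    unfold semiperimeter
    ring
  simp only
  linarith

lemma len_sq (P Q : ℤ × ℤ) :
    len P Q ^ 2 = ((Q.1 - P.1 : ℝ)) ^ 2 + ((Q.2 - P.2 : ℝ)) ^ 2 := by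
  unfold len toPlane
  rw [EuclideanSpace.dist_eq, Real.sq_sqrt (by positivity)]
  simp [Fin.sum_univ_two, Real.dist_eq, sq_abs]
  ring

/-- The detour through a point at vertical distance `t` from a segment is of second order in `t`:
the terms linear in `t` of the two partial lengths cancel. Here the segment has slope `σ` and the
vertical line through the point cuts its horizontal extent into `p` and `q`. -/
lemma add_le_of_near_segment {a b c p q σ t : ℝ} (hp : 0 < p) (hq : 0 < q) (hc0 : 0 ≤ c)
    (ha : a ^ 2 = p ^ 2 + (σ * p + t) ^ 2) (hb : b ^ 2 = q ^ 2 + (σ * q - t) ^ 2)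
    (hc : c ^ 2 = (p + q) ^ 2 + (σ * (p + q)) ^ 2) :
    a + b ≤ c + t ^ 2 / (2 * p) + t ^ 2 / (2 * q) := by
  obtain ⟨r, hr1, hr⟩ : ∃ r : ℝ, 1 ≤ r ∧ r ^ 2 = 1 + σ ^ 2 :=
    ⟨√(1 + σ ^ 2), Real.one_le_sqrt.2 (by nlinarith [sq_nonneg σ]), Real.sq_sqrt (by positivity)⟩
  have hr0 : 0 < r := by linarith
  have hce : c = (p + q) * r := by
    have : c ^ 2 = ((p + q) * r) ^ 2 := by
      rw [hc, mul_pow (p + q) r, hr]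
      ring
    exact (pow_left_inj₀ hc0 (by positivity) two_ne_zero).1 this
  have hside (x y s : ℝ) (hx : 0 < x) (hy : y ^ 2 = x ^ 2 + (σ * x + s) ^ 2) :
      y ≤ x * r + σ * s / r + s ^ 2 / (2 * x) := by
    have h1 : y ≤ (x ^ 2 * r ^ 2 + y ^ 2) / (2 * (x * r)) := by
      rw [le_div_iff₀ (by positivity)]
      nlinarith [sq_nonneg (y - x * r)]
    have h2 : (x ^ 2 * r ^ 2 + y ^ 2) / (2 * (x * r)) =
        x * r + σ * s / r + s ^ 2 / (2 * x * r) := by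
      have : y ^ 2 = x ^ 2 * r ^ 2 + 2 * σ * x * s + s ^ 2 := by rw [hy, hr]; ring
      rw [this]
      field_simp
      ring
    have h3 : s ^ 2 / (2 * x * r) ≤ s ^ 2 / (2 * x) := by
      apply div_le_div_of_nonneg_left (by positivity) (by positivity)
      nlinarith
    linarith
  have h1 := hside p a t hp ha
  have h2 := hside q b (-t) hq (by rw [hb]; ring)
  have h3 : σ * -t / r = -(σ * t / r) := by ring
  rw [h3, neg_sq] at h2
  rw [hce]
  linarith

lemma not_collinear_of_det_lt {A B C : ℤ × ℤ}
    (h : (B.1 - A.1) * (C.2 - A.2) < (C.1 - A.1) * (B.2 - A.2)) :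
    ¬ Collinear ℝ (toPlane '' (({A, B, C} : Finset (ℤ × ℤ)) : Set (ℤ × ℤ))) := by
  intro hcol
  rw [collinear_iff_of_mem (p₀ := toPlane A) (Set.mem_image_of_mem _ (by simp))] at hcol
  obtain ⟨v, hv⟩ := hcol
  obtain ⟨r, hr⟩ := hv (toPlane B) (Set.mem_image_of_mem _ (by simp))
  obtain ⟨s, hs⟩ := hv (toPlane C) (Set.mem_image_of_mem _ (by simp))
  have r0 := congrArg (fun w : EuclideanSpace ℝ (Fin 2) => w 0) hr
  have r1 := congrArg (fun w : EuclideanSpace ℝ (Fin 2) => w 1) hr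
  have s0 := congrArg (fun w : EuclideanSpace ℝ (Fin 2) => w 0) hs
  have s1 := congrArg (fun w : EuclideanSpace ℝ (Fin 2) => w 1) hs
  simp [toPlane] at r0 r1 s0 s1
  have h' : ((B.1 - A.1) * (C.2 - A.2) : ℝ) < (C.1 - A.1) * (B.2 - A.2) := by exact_mod_cast h
  rw [r0, r1, s0, s1] at h'
  nlinarith

/-- The lattice point in the column `x` that lies `k` rows above the last lattice point below or
on the line `AC`. For `k ≥ 1` it lies strictly above the line, by at most `k`. -/
def aboveLine (A C : ℤ × ℤ) (x k : ℤ) : ℤ × ℤ :=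
  (x, A.2 + (x - A.1) * (C.2 - A.2) / (C.1 - A.1) + k)

/-- The parameters `(A, C, x, k)` of a family of flat triangles `A`, `aboveLine A C x k`, `C`:
the columns of the three vertices range over three separated intervals, and the height `k` is at
most `d`. -/
noncomputable def flatParams (m d : ℕ) : Finset ((ℤ × ℤ) × (ℤ × ℤ) × ℤ × ℤ) :=
  (Finset.Ico (-3 * m : ℤ) (-2 * m) ×ˢ Finset.Ico (-m : ℤ) m) ×ˢ
    (Finset.Ico (2 * m : ℤ) (3 * m) ×ˢ Finset.Ico (-m : ℤ) m) ×ˢ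
    Finset.Ico (-m : ℤ) m ×ˢ Finset.Icc (1 : ℤ) d

lemma card_flatParams (m d : ℕ) : (flatParams m d).card = 8 * m ^ 5 * d := by
  simp only [flatParams, Finset.card_product, Int.card_Ico, Int.card_Icc]
  have h1 : (-2 * (m : ℤ) - -3 * m).toNat = m := by omega
  have h2 : ((m : ℤ) - -m).toNat = 2 * m := by omega
  have h3 : (3 * (m : ℤ) - 2 * m).toNat = m := by omega
  have h4 : ((d : ℤ) + 1 - 1).toNat = d := by omega
  rw [h1, h2, h3, h4]
  ring

/-- The vertex set of the flat triangle with the given parameters. -/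
def flatVertices (v : (ℤ × ℤ) × (ℤ × ℤ) × ℤ × ℤ) : Finset (ℤ × ℤ) :=
  {v.1, aboveLine v.1 v.2.1 v.2.2.1 v.2.2.2, v.2.1}

lemma mem_flatParams {m d : ℕ} {A C : ℤ × ℤ} {x k : ℤ} :
    (A, C, x, k) ∈ flatParams m d ↔
      ((-3 * m ≤ A.1 ∧ A.1 < -2 * m) ∧ -m ≤ A.2 ∧ A.2 < m) ∧
      ((2 * m ≤ C.1 ∧ C.1 < 3 * m) ∧ -m ≤ C.2 ∧ C.2 < m) ∧
      (-m ≤ x ∧ x < m) ∧ 1 ≤ k ∧ k ≤ d := by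
  simp only [flatParams, Finset.mem_product, Finset.mem_Ico, Finset.mem_Icc]

lemma flatVertices_injOn (m d : ℕ) : Set.InjOn flatVertices (flatParams m d) := by
  rintro ⟨A, C, x, k⟩ hv ⟨A', C', x', k'⟩ hv' h
  rw [Finset.mem_coe, mem_flatParams] at hv hv'
  simp only [flatVertices] at h
  have hA : A ∈ ({A', aboveLine A' C' x' k', C'} : Finset (ℤ × ℤ)) := by rw [← h]; simp
  have hB : aboveLine A C x k ∈ ({A', aboveLine A' C' x' k', C'} : Finset (ℤ × ℤ)) := by
    rw [← h]; simp
  have hC : C ∈ ({A', aboveLine A' C' x' k', C'} : Finset (ℤ × ℤ)) := by rw [← h]; simp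
  simp only [Finset.mem_insert, Finset.mem_singleton, aboveLine, Prod.ext_iff] at hA hB hC
  obtain rfl : A = A' := by
    rcases hA with h | h | h
    · exact Prod.ext h.1 h.2
    · have := h.1; omega
    · have := h.1; omega
  obtain rfl : C = C' := by
    rcases hC with h | h | h
    · have := h.1; omega
    · have := h.1; omega
    · exact Prod.ext h.1 h.2
  rcases hB with h | h | h
  · have := h.1; omega
  · obtain ⟨rfl, h2⟩ := h
    simpa using h2
  · have := h.1; omega

/-- The position of `aboveLine A C x k` relative to the line `AC`, multiplied by the width. -/
lemma aboveLine_bounds {A C : ℤ × ℤ} {x k : ℤ} (h : A.1 < C.1) (hk : 1 ≤ k) :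
    (x - A.1) * (C.2 - A.2) < (C.1 - A.1) * ((aboveLine A C x k).2 - A.2) ∧
    (C.1 - A.1) * ((aboveLine A C x k).2 - A.2) ≤
      (x - A.1) * (C.2 - A.2) + (C.1 - A.1) * k := by
  have hw : 0 < C.1 - A.1 := by omega
  have e : (aboveLine A C x k).2 - A.2 = (x - A.1) * (C.2 - A.2) / (C.1 - A.1) + k := by
    simp only [aboveLine]; ring
  rw [e]
  have h1 := Int.mul_ediv_add_emod ((x - A.1) * (C.2 - A.2)) (C.1 - A.1)
  have h2 := Int.emod_nonneg ((x - A.1) * (C.2 - A.2)) hw.ne'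
  have h3 := Int.emod_lt_of_pos ((x - A.1) * (C.2 - A.2)) hw
  constructor <;> nlinarith

/-- The height of `aboveLine A C x k` stays between the heights of `A` and `C`, up to `k`. -/
lemma abs_aboveLine_le {m d : ℕ} {A C : ℤ × ℤ} {x k : ℤ} (hv : (A, C, x, k) ∈ flatParams m d)
    (hd : d ≤ m) : |(aboveLine A C x k).2| ≤ 3 * m := by
  rw [mem_flatParams] at hv
  obtain ⟨⟨⟨a1, a2⟩, a3, a4⟩, ⟨⟨c1, c2⟩, c3, c4⟩, ⟨x1, x2⟩, k1, k2⟩ := hv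
  obtain ⟨b1, b2⟩ := aboveLine_bounds (A := A) (C := C) (x := x) (k := k) (by omega) k1
  have hw : 0 < C.1 - A.1 := by omega
  have hd' : (d : ℤ) ≤ m := by exact_mod_cast hd
  rw [abs_le]
  -- Both bounds express that a weighted mean of `A.2` and `C.2` lies in `[-m, m]`.
  constructor
  · have : (C.1 - A.1) * (-m) < (C.1 - A.1) * (aboveLine A C x k).2 := by
      nlinarith [mul_nonneg (show 0 ≤ x - A.1 by omega) (show 0 ≤ C.2 + m by omega),
        mul_nonneg (show 0 ≤ C.1 - x by omega) (show 0 ≤ A.2 + m by omega)]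
    have := lt_of_mul_lt_mul_left this hw.le
    omega
  · have : (C.1 - A.1) * (aboveLine A C x k).2 ≤ (C.1 - A.1) * (m + k) := by
      nlinarith [mul_nonneg (show 0 ≤ x - A.1 by omega) (show 0 ≤ m - C.2 by omega),
        mul_nonneg (show 0 ≤ C.1 - x by omega) (show 0 ≤ m - A.2 by omega)]
    have := le_of_mul_le_mul_left this hw
    omega

lemma shape_add_lt_of_flat {m d D : ℕ} (hD : 0 < D) (hd : D * d ≤ m) (T : LatticeTriangle)
    {A C : ℤ × ℤ} {x k : ℤ} (hv : (A, C, x, k) ∈ flatParams m d)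
    (hT : T.vertices = {A, aboveLine A C x k, C}) :
    T.shape.1.1 + T.shape.1.2 < 1 + 1 / (D : ℝ) ^ 2 := by
  rw [mem_flatParams] at hv
  obtain ⟨⟨⟨a1, a2⟩, a3, a4⟩, ⟨⟨c1, c2⟩, c3, c4⟩, ⟨x1, x2⟩, k1, k2⟩ := hv
  obtain ⟨b1, b2⟩ := aboveLine_bounds (A := A) (C := C) (x := x) (k := k) (by omega) k1
  set B := aboveLine A C x k with hB
  have hBx : B.1 = x := rfl
  have hm : (0 : ℝ) < m := by
    have : 0 < m := by omega
    exact_mod_cast this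
  have hDR : (0 : ℝ) < D := by exact_mod_cast hD
  have hp : (m : ℝ) ≤ x - A.1 := by
    have : (m : ℤ) ≤ x - A.1 := by omega
    exact_mod_cast this
  have hq : (m : ℝ) ≤ C.1 - x := by
    have : (m : ℤ) ≤ C.1 - x := by omega
    exact_mod_cast this
  have hw4 : (4 * m : ℝ) ≤ C.1 - A.1 := by
    have : (4 * m : ℤ) ≤ C.1 - A.1 := by omega
    exact_mod_cast this
  have hw : (0 : ℝ) < C.1 - A.1 := by linarith
  set σ : ℝ := (C.2 - A.2) / (C.1 - A.1) with hσ
  have hσw : σ * (C.1 - A.1) = C.2 - A.2 := by rw [hσ]; field_simp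
  set t : ℝ := B.2 - A.2 - σ * (x - A.1) with ht
  have htw : t * (C.1 - A.1) = (C.1 - A.1) * (B.2 - A.2) - (x - A.1) * (C.2 - A.2) := by
    rw [ht, ← hσw]; ring
  have b1' : ((x - A.1) * (C.2 - A.2) : ℝ) < (C.1 - A.1) * (B.2 - A.2) := by exact_mod_cast b1
  have b2' : ((C.1 - A.1) * (B.2 - A.2) : ℝ) ≤
      (x - A.1) * (C.2 - A.2) + (C.1 - A.1) * k := by exact_mod_cast b2
  have t0 : 0 < t := pos_of_mul_pos_left (by rw [htw]; linarith) hw.le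
  have tk : t ≤ k := le_of_mul_le_mul_right (by rw [htw]; linarith) hw
  have hkd : (k : ℝ) ≤ d := by exact_mod_cast k2
  have hdm : (D * d : ℝ) ≤ m := by exact_mod_cast hd
  have hDt : D * t ≤ m := by nlinarith
  have hc0 : 0 ≤ len C A := dist_nonneg
  have key := add_le_of_near_segment (a := len A B) (b := len B C) (c := len C A)
    (p := x - A.1) (q := C.1 - x) (σ := σ) (t := t) (by linarith) (by linarith) hc0
    (by rw [len_sq, hBx, ht]; ring)
    (by
      rw [len_sq, hBx]
      have : σ * (C.1 - x) - t = C.2 - B.2 := by rw [ht]; linarith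
      rw [this])
    (by
      rw [len_comm, len_sq]
      have : ((x : ℝ) - A.1 + (C.1 - x)) = C.1 - A.1 := by ring
      rw [this, hσw])
  have hcm : 4 * (m : ℝ) ≤ len C A := by
    refine le_of_sq_le_sq ?_ hc0
    rw [len_comm, len_sq]
    nlinarith [sq_nonneg ((C.2 : ℝ) - A.2)]
  have e1 : t ^ 2 / (2 * ((x : ℝ) - A.1)) ≤ t ^ 2 / (2 * m) :=
    div_le_div_of_nonneg_left (by positivity) (by positivity) (by linarith)
  have e2 : t ^ 2 / (2 * ((C.1 : ℝ) - x)) ≤ t ^ 2 / (2 * m) :=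
    div_le_div_of_nonneg_left (by positivity) (by positivity) (by linarith)
  have e3 : t ^ 2 / (2 * (m : ℝ)) ≤ m / (2 * D ^ 2) := by
    rw [div_le_div_iff₀ (by positivity) (by positivity)]
    nlinarith [mul_self_le_mul_self (by positivity) hDt]
  have hdet : len A B + len B C ≤ len C A + m / D ^ 2 := by
    have : (m : ℝ) / (2 * D ^ 2) + m / (2 * D ^ 2) = m / D ^ 2 := by field_simp; ring
    linarith
  have hAC : len C A ≤ len A B + len B C := by
    have hle : len A C ≤ len A B + len B C := dist_triangle _ _ _
    rwa [len_comm A C] at hle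
  have hs : 0 < semiperimeter A B C := by unfold semiperimeter; linarith
  refine (T.shape_add_le hT).trans_lt ?_
  -- `1 - c / s = (a + b - c) / (a + b + c)`, where the numerator is at most `m / D ^ 2` and the
  -- denominator at least `8 * m`.
  have h1 : 1 - len C A / semiperimeter A B C < 1 / (D : ℝ) ^ 2 := by
    rw [one_sub_div hs.ne', div_lt_div_iff₀ hs (by positivity)]
    have h2 : semiperimeter A B C - len C A ≤ m / D ^ 2 / 2 := by
      unfold semiperimeter; linarith
    have h3 : (m : ℝ) / D ^ 2 / 2 * D ^ 2 = m / 2 := by field_simp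
    have h4 : (semiperimeter A B C - len C A) * D ^ 2 ≤ m / 2 := by
      rw [← h3]
      exact mul_le_mul_of_nonneg_right h2 (by positivity)
    have h5 : 4 * (m : ℝ) ≤ semiperimeter A B C := by unfold semiperimeter; linarith
    linarith
  linarith

/-! ### Counting lattice triangles -/

lemma LatticeTriangle.vertices_injective : Function.Injective LatticeTriangle.vertices := by
  rintro ⟨v, _, _⟩ ⟨w, _, _⟩ h
  simp only at h
  subst h
  rfl

open Classical in
/-- Of the lattice triangles in a square of size `m`, whose number is of order `m ^ 6`, a proportion
of order at least `d / m` is flat of order `(d / m) ^ 2`. -/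
lemma le_card_flat {m d D N : ℕ} (hD : 0 < D) (hd : D * d ≤ m) (hN : 3 * m ≤ N) :
    8 * m ^ 5 * d ≤ ((trianglesInSquare_finite N).toFinset.filter
      fun T => T.shape ∈ flatShapes (1 / (D : ℝ) ^ 2)).card := by
  rw [← card_flatParams, ← Finset.card_image_of_injective _ LatticeTriangle.vertices_injective]
  refine Finset.card_le_card_of_injOn flatVertices ?_ (flatVertices_injOn m d)
  rintro ⟨A, C, x, k⟩ hv
  rw [Finset.mem_coe] at hv
  have hdm : d ≤ m := by nlinarith
  have hy := abs_aboveLine_le hv hdm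
  have hv' := mem_flatParams.1 hv
  have hb := aboveLine_bounds (A := A) (C := C) (x := x) (k := k) (by omega) hv'.2.2.2.1
  let T : LatticeTriangle :=
    { vertices := {A, aboveLine A C x k, C}
      card_eq := by
        have hBx : (aboveLine A C x k).1 = x := rfl
        refine Finset.card_eq_three.2 ⟨_, _, _, ?_, ?_, ?_, rfl⟩ <;>
          intro h <;> have := congrArg Prod.fst h <;> omega
      not_collinear := not_collinear_of_det_lt hb.1 }
  rw [Finset.mem_coe, Finset.mem_image]
  refine ⟨T, ?_, rfl⟩
  rw [Finset.mem_filter, Set.Finite.mem_toFinset]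
  refine ⟨?_, shape_add_lt_of_flat hD hd T hv rfl⟩
  intro p hp
  have hp' : p = A ∨ p = aboveLine A C x k ∨ p = C := by simpa [T] using hp
  simp only [abs_le] at hy ⊢
  rcases hp' with rfl | rfl | rfl
  · omega
  · have hBx : (aboveLine A C x k).1 = x := rfl
    omega
  · omega

lemma card_trianglesInSquare_le (N : ℕ) :
    (trianglesInSquare_finite N).toFinset.card ≤ (2 * N + 1) ^ 6 := by
  classical
  rw [← Finset.card_image_of_injective _ LatticeTriangle.vertices_injective]
  set S : Finset (ℤ × ℤ) := Finset.Icc (-(N : ℤ)) N ×ˢ Finset.Icc (-(N : ℤ)) N with hS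
  have hcard : S.card = (2 * N + 1) ^ 2 := by
    have : ((N : ℤ) + 1 - -N).toNat = 2 * N + 1 := by omega
    rw [hS, Finset.card_product, Int.card_Icc, this]
    ring
  have hsub : (trianglesInSquare_finite N).toFinset.image LatticeTriangle.vertices ⊆
      S.powersetCard 3 := by
    intro v hv
    obtain ⟨T, hT, rfl⟩ := Finset.mem_image.1 hv
    rw [Set.Finite.mem_toFinset] at hT
    refine Finset.mem_powersetCard.2 ⟨fun p hp => ?_, T.card_eq⟩
    have := hT p hp
    simp only [abs_le] at this
    simpa [hS] using this
  calc _ ≤ (S.powersetCard 3).card := Finset.card_le_card hsub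
    _ = ((2 * N + 1) ^ 2).choose 3 := by rw [Finset.card_powersetCard, hcard]
    _ ≤ ((2 * N + 1) ^ 2) ^ 3 := Nat.choose_le_pow _ _
    _ = _ := by ring

open Classical in
lemma card_trianglesInSquare_le_mul_flat {D N : ℕ} (hD : 0 < D) (hN : 15 * D ≤ N) :
    (trianglesInSquare_finite N).toFinset.card ≤ 30000 * D *
      ((trianglesInSquare_finite N).toFinset.filter
        fun T => T.shape ∈ flatShapes (1 / (D : ℝ) ^ 2)).card := by
  set m := N / 3 with hm
  set d := m / D with hd
  have hmD : 5 * D ≤ m := by omega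
  have h1 : D * d ≤ m := Nat.mul_div_le m D
  have h2 : m ≤ 2 * (D * d) := by
    have h3 : m < D * d + D := Nat.lt_mul_div_succ m hD
    have h4 : 1 ≤ d := (Nat.one_le_div_iff hD).2 (by omega)
    nlinarith
  have h5 : 2 * N + 1 ≤ 7 * m := by omega
  calc _ ≤ (2 * N + 1) ^ 6 := card_trianglesInSquare_le N
    _ ≤ (7 * m) ^ 6 := Nat.pow_le_pow_left h5 6
    _ = 117649 * m ^ 5 * m := by ring
    _ ≤ 117649 * m ^ 5 * (2 * (D * d)) := Nat.mul_le_mul_left _ h2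
    _ ≤ 30000 * D * (8 * m ^ 5 * d) := by
        have := Nat.zero_le (D * d * m ^ 5)
        nlinarith
    _ ≤ _ := Nat.mul_le_mul_left _ (le_card_flat hD h1 (by omega))

lemma le_totalWeight_latticeShapes (N : ℕ) : N / 3 ≤ totalWeight (latticeShapes N) := by
  classical
  rw [totalWeight_latticeShapes]
  have h := (le_card_flat (m := N / 3) (d := N / 3) (D := 1) (N := N) one_pos (by omega)
    (by omega)).trans (Finset.card_filter_le _ _)
  refine le_trans ?_ h
  rcases Nat.eq_zero_or_pos (N / 3) with h0 | h0
  · omega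
  · exact Nat.le_mul_of_pos_left _ (by positivity)

lemma tendsto_totalWeight_latticeShapes :
    Tendsto (fun N => totalWeight (latticeShapes N)) atTop atTop :=
  tendsto_atTop_mono le_totalWeight_latticeShapes (Nat.tendsto_div_const_atTop (by norm_num))

/-! ### Failure of equidistribution -/

/-- For `D = 10 ^ 7`, the flat shapes carry a proportion at least `1 / (30000 * D)` of the lattice
triangles but at most `200 / D ^ 2` of the area. -/
lemma not_tendsto_proportion_flat :
    ¬ Tendsto (fun N => diracMeasure (latticeShapes N) (flatShapes (1 / ((10 ^ 7 : ℕ) : ℝ) ^ 2)) /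
        (totalWeight (latticeShapes N) : ENNReal)) atTop
      (𝓝 (area ModuliSpace (flatShapes (1 / ((10 ^ 7 : ℕ) : ℝ) ^ 2)) /
        area ModuliSpace Set.univ)) := by
  classical
  intro h
  have hlow : ∀ᶠ N in atTop, ENNReal.ofReal (1 / (3 * 10 ^ 11)) ≤
      diracMeasure (latticeShapes N) (flatShapes (1 / ((10 ^ 7 : ℕ) : ℝ) ^ 2)) /
        (totalWeight (latticeShapes N) : ENNReal) := by
    filter_upwards [eventually_ge_atTop (15 * 10 ^ 7)] with N hN
    have hc := card_trianglesInSquare_le_mul_flat (D := 10 ^ 7) (by norm_num) hN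
    have hpos := le_totalWeight_latticeShapes N
    rw [diracMeasure_latticeShapes_apply N (isOpen_flatShapes _).measurableSet]
    rw [← totalWeight_latticeShapes] at hc
    set w := totalWeight (latticeShapes N)
    have hw : 0 < w := by omega
    rw [ENNReal.le_div_iff_mul_le (Or.inl (by exact_mod_cast hw.ne'))
      (Or.inl (ENNReal.natCast_ne_top _)), ← ENNReal.ofReal_natCast w,
      ← ENNReal.ofReal_natCast, ← ENNReal.ofReal_mul (by positivity)]
    refine ENNReal.ofReal_le_ofReal ?_
    have hc' : (w : ℝ) ≤ _ := Nat.cast_le.2 hc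
    rw [Nat.cast_mul] at hc'
    norm_num at hc' ⊢
    linarith
  have h1 := ge_of_tendsto h hlow
  have h2 : area ModuliSpace (flatShapes (1 / ((10 ^ 7 : ℕ) : ℝ) ^ 2)) /
      area ModuliSpace Set.univ ≤ ENNReal.ofReal (2 / 10 ^ 12) := by
    refine (ENNReal.div_le_div (area_flatShapes_le (by positivity)) le_area_moduliSpace).trans ?_
    rw [← ENNReal.ofReal_div_of_pos (by norm_num)]
    refine ENNReal.ofReal_le_ofReal ?_
    norm_num
  have h3 := (ENNReal.ofReal_le_ofReal_iff (by norm_num)).1 (h1.trans h2)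
  norm_num at h3

lemma diracMeasure_univ {X : Type*} [MeasurableSpace X] (S : WeightedSet X) :
    diracMeasure S Set.univ = totalWeight S := by
  simp [diracMeasure, totalWeight, Finsupp.sum, Measure.finsetSum_apply]

lemma finiteMeasure_normalize_apply {X : Type*} [MeasurableSpace X] [Nonempty X]
    (μ : FiniteMeasure X)
    (hμ : (μ : Measure X) Set.univ ≠ 0) (R : Set X) :
    (μ.normalize : Measure X) R = (μ : Measure X) R / (μ : Measure X) Set.univ := by
  have h0 : μ ≠ 0 := by
    rintro rfl
    simp at hμ
  rw [FiniteMeasure.toMeasure_normalize_eq_of_nonzero μ h0, Measure.smul_apply,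
    ENNReal.div_eq_inv_mul, ENNReal.smul_def, smul_eq_mul, ENNReal.coe_inv (by simpa using h0),
    FiniteMeasure.ennreal_mass]

end LatticeTriangles

theorem theorem2 :
    Tendsto (fun N => LatticeTriangles.totalWeight (LatticeTriangles.latticeShapes N)) atTop atTop ∧
    ¬ LatticeTriangles.Equidistributes LatticeTriangles.ModuliSpace
        LatticeTriangles.latticeShapes ∧
    ¬ Tendsto
        (fun N => (LatticeTriangles.countingMeasure (LatticeTriangles.latticeShapes N)).normalize)
        atTop (𝓝 LatticeTriangles.areaMeasure.normalize) := by
  open LatticeTriangles in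
  refine ⟨tendsto_totalWeight_latticeShapes, fun h => not_tendsto_proportion_flat ?_,
    fun h => not_tendsto_proportion_flat ?_⟩
  · exact h _ (isOpen_flatShapes _) (isConnected_flatShapes (by positivity) (by norm_num))
      (area_frontier_flatShapes _)
  · have harea : (areaMeasure : Measure ModuliSpace) Set.univ ≠ 0 :=
      (lt_of_lt_of_le (by simp) le_area_moduliSpace).ne'
    have hfr : (areaMeasure.normalize : Measure ModuliSpace)
        (frontier (flatShapes (1 / ((10 ^ 7 : ℕ) : ℝ) ^ 2))) = 0 := by
      rw [finiteMeasure_normalize_apply _ harea]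
      exact ENNReal.div_eq_zero_iff.2 (Or.inl (area_frontier_flatShapes _))
    have ht := ProbabilityMeasure.tendsto_measure_of_null_frontier_of_tendsto' h hfr
    rw [finiteMeasure_normalize_apply _ harea] at ht
    refine ht.congr' ?_
    filter_upwards [eventually_ge_atTop 3] with N hN
    have hw : (countingMeasure (latticeShapes N) : Measure ModuliSpace) Set.univ ≠ 0 := by
      change diracMeasure (latticeShapes N) Set.univ ≠ 0
      have := le_totalWeight_latticeShapes N
      rw [diracMeasure_univ, Nat.cast_ne_zero]
      omega
    rw [finiteMeasure_normalize_apply _ hw, ← diracMeasure_univ]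
    rfl
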